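/- **Theorem.** Let $W\subset\mathbb{C}^n$ be an irreducible (affine algebraic) variety, that is, a nonempty common zero set of complex polynomials that is not the union of two proper subvarieties. Let $\overline{W}$ be its coordinatewise complex conjugate, let $V=W\cup\overline{W}$, and let $\mathbb{R}[V]=\mathbb{R}[x_1,\dots,x_n]/I_{\mathbb R}(V)$, where $I_{\mathbb R}(V)$ is the ideal of real polynomials vanishing on $V$. Let $\mathcal{L}\subset\mathbb{R}[V]$ be a real linear subspace of finite dimension $D$, and let $S\ge D/2$ be a natural number. Then for a conjugate-generic $S$-tuple $Z=(z_1,\dots,z_S)$ of points of $W$ the pair $(\mathcal{L},Z)$ is poised, meaning that the only $f\in\mathcal{L}$ with $f(z_1)=\dots=f(z_S)=0$ is $f=0$. Explicitly, there is a polynomial $q$ with complex coefficients in the coordinates of $z_1,\dots,z_S,\overline{z_1},\dots,\overline{z_S}$ such that - $q(z_1,\dots,z_S,\overline{z_1},\dots,\overline{z_S})$ is not identically zero for $z_1,\dots,z_S\in W$, and - whenever $z_1,\dots,z_S\in W$ and $q(z_1,\dots,z_S,\overline{z_1},\dots,\overline{z_S})\neq 0$, the pair $(\mathcal{L},(z_1,\dots,z_S))$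 is poised. -/

import Mathlib

open scoped ComplexConjugate

/-- `W ⊆ ℂⁿ` is a (complex affine algebraic) variety: the common zero set in `ℂⁿ`
of an ideal of complex polynomials. -/
def IsVariety {n : ℕ} (W : Set (Fin n → ℂ)) : Prop :=
  ∃ I : Ideal (MvPolynomial (Fin n) ℂ), W = MvPolynomial.zeroLocus ℂ I

/-- An irreducible variety: a nonempty variety that is not the union of two proper subvarieties. -/
def IsIrreducibleVariety {n : ℕ} (W : Set (Fin n → ℂ)) : Prop :=
  IsVariety W ∧ W.Nonempty ∧
    ∀ A B : Set (Fin n → ℂ), IsVariety A → IsVariety B → W = A ∪ B → A = W ∨ B = W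

/-- The coordinatewise complex conjugate of a subset of `ℂⁿ`. -/
def conjSet {n : ℕ} (W : Set (Fin n → ℂ)) : Set (Fin n → ℂ) :=
  (fun (z : Fin n → ℂ) (k : Fin n) => conj (z k)) '' W

/-- The real coordinate ring `ℝ[V] = ℝ[x] / I_ℝ(V)`, where `I_ℝ(V)` is the ideal of the real
polynomials that vanish at every point of `V ⊆ ℂⁿ`. -/
abbrev RealCoordRing {n : ℕ} (V : Set (Fin n → ℂ)) : Type :=
  MvPolynomial (Fin n) ℝ ⧸ MvPolynomial.vanishingIdeal ℝ V

/-- The value of an element of `ℝ[V]` at a point of `V`. -/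
noncomputable def RealCoordRing.evalAt {n : ℕ} {V : Set (Fin n → ℂ)} (z : V) :
    RealCoordRing V →ₐ[ℝ] ℂ :=
  Ideal.Quotient.liftₐ (MvPolynomial.vanishingIdeal ℝ V)
    (MvPolynomial.aeval (z : Fin n → ℂ))
    (fun _ hf => hf z.1 z.2)

/-- `(L, Z)` is poised: the only element of `L` that vanishes at all points of `Z` is zero. -/
def Poised {n : ℕ} {V : Set (Fin n → ℂ)} (L : Submodule ℝ (RealCoordRing V)) (Z : Set V) : Prop :=
  ∀ q ∈ L, (∀ z ∈ Z, RealCoordRing.evalAt z q = 0) → q = 0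

/-- The value `q(z₁, …, z_S, conj z₁, …, conj z_S)`. The variable `Sum.inl (i, k)` stands for the
`k`-th coordinate of `zᵢ`, and `Sum.inr (i, k)` for the `k`-th coordinate of `conj zᵢ`. -/
noncomputable def evalConj {n S : ℕ}
    (q : MvPolynomial ((Fin S × Fin n) ⊕ (Fin S × Fin n)) ℂ) (Z : Fin S → Fin n → ℂ) : ℂ :=
  MvPolynomial.eval (Sum.elim (fun ik => Z ik.1 ik.2) (fun ik => conj (Z ik.1 ik.2))) q

/-- A property `P` of `S`-tuples of points of `W` holds conjugate-generically: for some polynomial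
in the samples and their conjugates that is not identically zero on `S`-tuples from `W`, the
property holds for every tuple at which the polynomial is nonzero. -/
def CGenerically {n : ℕ} (W : Set (Fin n → ℂ)) (S : ℕ) (P : (Fin S → W) → Prop) : Prop :=
  ∃ q : MvPolynomial ((Fin S × Fin n) ⊕ (Fin S × Fin n)) ℂ,
    (∃ Z : Fin S → W, evalConj q (fun i => (Z i : Fin n → ℂ)) ≠ 0) ∧
    ∀ Z : Fin S → W, evalConj q (fun i => (Z i : Fin n → ℂ)) ≠ 0 → P Z

/-- The samples of a tuple from `W`, as a subset of `V = W ∪ conj W`. -/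
def sampleSet {n S : ℕ} {W : Set (Fin n → ℂ)} (Z : Fin S → W) : Set ↥(W ∪ conjSet W) :=
  Set.range (fun i => (⟨(Z i : Fin n → ℂ), Or.inl (Z i).2⟩ : ↥(W ∪ conjSet W)))

/-!
Choosing `S` samples imposes `2 S` real linear conditions on `L`, so the point is that each sample
can be chosen to lower the dimension by two (or down to zero), and that the good tuples are cut out
by one polynomial.

*One sample.* Let `f, g ∈ L` be linearly independent over `ℝ`. If at every `z ∈ W` the values
`f z, g z` were real multiples of one another, then `f / g` would take only real values on the part
of `W` where `g ≠ 0`. A regular function on an irreducible variety that omits uncountably many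
values is constant (`IsIrreducibleVariety.exists_eq_mul_of_ratio_omits`): if it omits `c`, the
Nullstellensatz puts `1 / (f / g - c)` into `ℂ[W][1 / g]`, which has countable dimension, while for
transcendental `f / g` these inverses are linearly independent over `ℂ`. The constant is then real,
so `f` is a real multiple of `g` on `W`, hence also on `conj W`, a contradiction. Therefore
evaluation at a suitable `z` maps `L` onto `ℂ`, and its kernel has codimension two
(`IsIrreducibleVariety.exists_finrank_inf_ker_add_two_le`). Induction on `S` gives one poised tuple
(`IsIrreducibleVariety.exists_poised`).

*Genericity.* For a basis `b` of `L`, the tuple `Z` is poised exactly when the positive semidefinite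
quadratic form `f ↦ ∑ i, 2 |f (Z i)| ^ 2` on `L` is definite, that is, when the determinant of its
Gram matrix is nonzero (`det_sampleGram_ne_zero_iff`). The entries are polynomials in the samples
and their conjugates, so this determinant is the required polynomial.
-/

open MvPolynomial Cardinal

/-! ### Irreducible varieties and their vanishing ideals -/

theorem IsIrreducibleVariety.zeroLocus_vanishingIdeal {n : ℕ} {W : Set (Fin n → ℂ)}
    (hW : IsIrreducibleVariety W) : zeroLocus ℂ (vanishingIdeal ℂ W) = W := by
  obtain ⟨⟨I, rfl⟩, -, -⟩ := hW
  exact le_antisymm (zeroLocus_anti_mono (le_vanishingIdeal_zeroLocus I))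
    (zeroLocus_vanishingIdeal_le _)

theorem IsIrreducibleVariety.mem_zeroLocus_sup_span {n : ℕ} {W : Set (Fin n → ℂ)}
    (hW : IsIrreducibleVariety W) (p : MvPolynomial (Fin n) ℂ) (z : Fin n → ℂ) :
    z ∈ zeroLocus ℂ (vanishingIdeal ℂ W ⊔ Ideal.span {p}) ↔ z ∈ W ∧ aeval z p = 0 := by
  constructor
  · intro hz
    refine ⟨?_, hz p (Ideal.mem_sup_right (Ideal.mem_span_singleton_self p))⟩
    rw [← hW.zeroLocus_vanishingIdeal]
    exact zeroLocus_anti_mono le_sup_left hz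
  · rintro ⟨hz, hp⟩ q hq
    obtain ⟨a, ha, b, hb, rfl⟩ := Submodule.mem_sup.1 hq
    obtain ⟨s, rfl⟩ := Ideal.mem_span_singleton'.1 hb
    rw [map_add, map_mul, hp, ha z hz, mul_zero, add_zero]

theorem IsIrreducibleVariety.isPrime_vanishingIdeal {n : ℕ} {W : Set (Fin n → ℂ)}
    (hW : IsIrreducibleVariety W) : (vanishingIdeal ℂ W).IsPrime := by
  refine ⟨fun h => ?_, fun {f g} hfg => ?_⟩
  · obtain ⟨z, hz⟩ := hW.2.1
    have h1 : (1 : MvPolynomial (Fin n) ℂ) ∈ vanishingIdeal ℂ W := h ▸ Submodule.mem_top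
    simpa using h1 z hz
  · have key (p : MvPolynomial (Fin n) ℂ) : IsVariety {z ∈ W | aeval z p = 0} := by
      refine ⟨vanishingIdeal ℂ W ⊔ Ideal.span {p}, ?_⟩
      ext z
      simp only [hW.mem_zeroLocus_sup_span, Set.mem_ofPred_eq]
    rcases hW.2.2 _ _ (key f) (key g) (by
      ext z
      have := hfg z
      simp only [map_mul, mul_eq_zero] at this
      simp only [Set.mem_union, Set.mem_ofPred_eq]
      tauto) with h | h
    · exact Or.inl fun z hz => (h.symm ▸ hz : z ∈ {z ∈ W | aeval z f = 0}).2
    · exact Or.inr fun z hz => (h.symm ▸ hz : z ∈ {z ∈ W | aeval z g = 0}).2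

/-! ### Rational functions that omit uncountably many values -/

theorem Ideal.exists_algHom_field_ker_eq.{u, v} {R : Type u} [CommRing R] (F : Type v) [Field F]
    [Algebra F R] (P : Ideal R) [P.IsPrime] :
    ∃ (K : Type u) (_ : Field K) (_ : Algebra F K) (φ : R →ₐ[F] K), ∀ r, φ r = 0 ↔ r ∈ P := by
  refine ⟨FractionRing (R ⧸ P), inferInstance, inferInstance,
    (IsScalarTower.toAlgHom F (R ⧸ P) (FractionRing (R ⧸ P))).comp (Ideal.Quotient.mkₐ F P),
    fun r => ?_⟩
  simp only [AlgHom.comp_apply, IsScalarTower.coe_toAlgHom', Ideal.Quotient.mkₐ_eq_mk]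
  rw [FaithfulSMul.algebraMap_eq_zero_iff, Ideal.Quotient.eq_zero_iff_mem]

/-- A subspace of countable dimension cannot contain `(x - a)⁻¹` for uncountably many `a`, because
these elements are linearly independent when `x` is transcendental. -/
theorem Transcendental.exists_sub_inv_notMem_span {F E ι : Type*} [Field F] [Field E]
    [Algebra F E] [Countable ι] {x : E} (hx : Transcendental F x) (v : ι → E) {T : Set F}
    (hT : ¬ T.Countable) :
    ∃ a ∈ T, (x - algebraMap F E a)⁻¹ ∉ Submodule.span F (Set.range v) := by
  by_contra! h
  have hli : LinearIndependent F (fun a : T =>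
      (⟨_, h a.1 a.2⟩ : Submodule.span F (Set.range v))) :=
    LinearIndependent.of_comp (Submodule.subtype _)
      (hx.linearIndependent_sub_inv.comp _ Subtype.val_injective)
  have h1 := hli.cardinal_lift_le_rank.trans
    (lift_le.2 ((rank_span_le _).trans (Set.countable_range v).le_aleph0))
  rw [lift_aleph0, lift_le_aleph0] at h1
  exact hT (le_aleph0_iff_set_countable.1 h1)

/-- If the rational function `f / g` on an irreducible variety omits every value in an uncountable
set `T`, then it is constant (or `g` vanishes identically). -/
theorem IsIrreducibleVariety.exists_eq_mul_of_ratio_omits {n : ℕ} {W : Set (Fin n → ℂ)}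
    (hW : IsIrreducibleVariety W) (f g : MvPolynomial (Fin n) ℂ) {T : Set ℂ}
    (hT : ¬ T.Countable)
    (h : ∀ c ∈ T, ∀ z ∈ W, aeval z f = c * aeval z g → aeval z g = 0) :
    (∀ z ∈ W, aeval z g = 0) ∨ ∃ c : ℂ, ∀ z ∈ W, aeval z f = c * aeval z g := by
  have hP := hW.isPrime_vanishingIdeal
  set P := vanishingIdeal ℂ W
  by_cases hg : g ∈ P
  · exact Or.inl hg
  right
  obtain ⟨K, _, _, φ, hφ⟩ := P.exists_algHom_field_ker_eq ℂ
  have hg0 : φ g ≠ 0 := fun h0 => hg ((hφ g).1 h0)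
  have hφC (c : ℂ) : φ (C c) = algebraMap ℂ K c := φ.commutes c
  suffices halg : IsAlgebraic ℂ (φ f / φ g) by
    obtain ⟨c, hc⟩ := minpoly.mem_range_of_degree_eq_one ℂ (φ f / φ g)
      (IsAlgClosed.degree_eq_one_of_irreducible ℂ (minpoly.irreducible halg.isIntegral))
    refine ⟨c, fun z hz => ?_⟩
    have hmem : f - C c * g ∈ P := by
      rw [← hφ, map_sub, map_mul, hφC, hc]
      field_simp
      simp
    have := hmem z hz
    simpa [sub_eq_zero] using this
  by_contra htr
  -- This countable family spans the image of `ℂ[W][1 / g]` in `K`.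
  let v : (Fin n →₀ ℕ) × ℕ → K := fun mk => φ (monomial mk.1 1) / φ g ^ mk.2
  obtain ⟨c, hcT, hc⟩ := Transcendental.exists_sub_inv_notMem_span htr v hT
  apply hc
  -- Since `f / g` omits `c`, every zero of `f - c g` on `W` is a zero of `g`.
  have hrad : g ∈ (P ⊔ Ideal.span {f - C c * g}).radical := by
    rw [← vanishingIdeal_zeroLocus_eq_radical (K := ℂ)]
    intro z hz
    rw [hW.mem_zeroLocus_sup_span] at hz
    exact h c hcT z hz.1 (by simpa [sub_eq_zero] using hz.2)
  obtain ⟨m, hm⟩ := hrad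
  obtain ⟨p, hp, r, hr, hsum⟩ := Submodule.mem_sup.1 hm
  obtain ⟨s, rfl⟩ := Ideal.mem_span_singleton'.1 hr
  have heq : φ s * (φ f - algebraMap ℂ K c * φ g) = φ g ^ m := by
    rw [← map_pow, ← hsum, map_add, (hφ p).2 hp, zero_add, map_mul, map_sub, map_mul, hφC]
  have hne : φ f - algebraMap ℂ K c * φ g ≠ 0 := fun h0 => by
    rw [h0, mul_zero] at heq
    exact pow_ne_zero m hg0 heq.symm
  have hinv : (φ f / φ g - algebraMap ℂ K c)⁻¹ = φ (s * g) / φ g ^ m := by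
    have : φ f / φ g - algebraMap ℂ K c = (φ f - algebraMap ℂ K c * φ g) / φ g := by
      field_simp
    rw [this, inv_div, map_mul, ← heq, div_eq_div_iff hne (heq ▸ pow_ne_zero m hg0)]
    ring
  rw [hinv, (s * g).as_sum, map_sum, Finset.sum_div]
  refine Submodule.sum_mem _ fun d _ => ?_
  have : φ (monomial d (coeff d (s * g))) / φ g ^ m = coeff d (s * g) • v (d, m) := by
    rw [← mul_one (coeff d (s * g)), ← smul_eq_mul, ← smul_monomial, map_smul, smul_eq_mul,
      mul_one, smul_div_assoc]
  rw [this]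
  exact Submodule.smul_mem _ _ (Submodule.subset_span ⟨_, rfl⟩)

/-! ### Evaluating real regular functions at points of `W` -/

theorem aeval_conj {σ : Type*} (z : σ → ℂ) (p : MvPolynomial σ ℝ) :
    aeval (fun k => conj (z k)) p = conj (aeval z p) := by
  have := comp_aeval_apply (fun k => z k) Complex.conjAe.toAlgHom p
  simpa using this.symm

/-- The value at a point of `W` of a real regular function on `W ∪ conj W`. -/
noncomputable def evalLeft {n : ℕ} {W : Set (Fin n → ℂ)} (z : W) :
    RealCoordRing (W ∪ conjSet W) →ₐ[ℝ] ℂ :=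
  RealCoordRing.evalAt ⟨z, Or.inl z.2⟩

theorem evalLeft_mk {n : ℕ} {W : Set (Fin n → ℂ)} (z : W) (p : MvPolynomial (Fin n) ℝ) :
    evalLeft z (Ideal.Quotient.mk _ p) = aeval (z : Fin n → ℂ) p :=
  rfl

/-- Real coefficients make the values on `conj W` the conjugates of those on `W`, so an element of
`ℝ[V]` is determined by its values on `W`. -/
theorem eq_zero_of_evalLeft_eq_zero {n : ℕ} {W : Set (Fin n → ℂ)}
    {f : RealCoordRing (W ∪ conjSet W)} (h : ∀ z : W, evalLeft z f = 0) : f = 0 := by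
  obtain ⟨p, rfl⟩ := Ideal.Quotient.mk_surjective f
  rw [Ideal.Quotient.eq_zero_iff_mem]
  rintro z (hz | ⟨w, hw, rfl⟩)
  · exact h ⟨z, hz⟩
  · have h0 : aeval w p = 0 := h ⟨w, hw⟩
    rw [aeval_conj, h0, map_zero]

theorem poised_sampleSet_iff {n S : ℕ} {W : Set (Fin n → ℂ)}
    {L : Submodule ℝ (RealCoordRing (W ∪ conjSet W))} {Z : Fin S → W} :
    Poised L (sampleSet Z) ↔ ∀ f ∈ L, (∀ i, evalLeft (Z i) f = 0) → f = 0 := by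
  simp only [Poised, sampleSet, Set.forall_mem_range]
  rfl

/-! ### Choosing one sample, and then all of them -/

theorem Complex.not_countable_im_ne_zero : ¬ {c : ℂ | c.im ≠ 0}.Countable := by
  intro h
  have h2 := h.preimage (f := fun r : ℝ => (⟨r, 1⟩ : ℂ)) (fun a b hab => congrArg Complex.re hab)
  exact Set.not_countable_univ (h2.mono fun r _ => by simp)

/-- Real-linearly independent `f` and `g` take `ℝ`-linearly independent values in `ℂ` at some point
of `W`: otherwise `f / g` would be real-valued, hence constant. -/
theorem IsIrreducibleVariety.exists_im_mul_conj_ne_zero {n : ℕ} {W : Set (Fin n → ℂ)}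
    (hW : IsIrreducibleVariety W) {f g : RealCoordRing (W ∪ conjSet W)}
    (hfg : LinearIndependent ℝ ![f, g]) :
    ∃ z : W, (evalLeft z f * conj (evalLeft z g)).im ≠ 0 := by
  by_contra! h
  rw [LinearIndependent.pair_iff] at hfg
  obtain ⟨p, rfl⟩ := Ideal.Quotient.mk_surjective f
  obtain ⟨q, rfl⟩ := Ideal.Quotient.mk_surjective g
  have hg : ¬ ∀ z : W, evalLeft z (Ideal.Quotient.mk _ q) = 0 := fun h0 => by
    have := hfg 0 1 (by rw [eq_zero_of_evalLeft_eq_zero h0]; simp)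
    simp at this
  have hreal (c : ℂ) (z : W) (hz : evalLeft z (Ideal.Quotient.mk _ q) ≠ 0)
      (hc : evalLeft z (Ideal.Quotient.mk _ p) = c * evalLeft z (Ideal.Quotient.mk _ q)) :
      c.im = 0 := by
    have h1 := h z
    rw [hc, mul_assoc, Complex.mul_conj, Complex.im_mul_ofReal, mul_eq_zero,
      Complex.normSq_eq_zero] at h1
    exact h1.resolve_right hz
  rcases hW.exists_eq_mul_of_ratio_omits (map (algebraMap ℝ ℂ) p) (map (algebraMap ℝ ℂ) q)
    Complex.not_countable_im_ne_zero (fun c hc z hz hz2 => by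
      by_contra hz3
      simp only [aeval_map_algebraMap] at hz2 hz3
      exact hc (hreal c ⟨z, hz⟩ hz3 hz2)) with h0 | ⟨c, hc⟩
  · refine hg fun z => ?_
    rw [evalLeft_mk]
    simpa only [aeval_map_algebraMap] using h0 z z.2
  · simp only [aeval_map_algebraMap] at hc
    push Not at hg
    obtain ⟨z, hz⟩ := hg
    -- Evaluating at a point where `g ≠ 0` shows that the constant ratio `c` is real.
    have hcr : ((c.re : ℝ) : ℂ) = c :=
      Complex.ext (by simp) (by simpa using (hreal c z hz (hc z z.2)).symm)
    have := hfg 1 (-c.re) (eq_zero_of_evalLeft_eq_zero fun w => by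
      rw [map_add, map_smul, map_smul, evalLeft_mk, evalLeft_mk, hc w w.2]
      simp [hcr])
    simp at this

/-- Requiring a zero at one suitable point of `W` lowers the dimension of `L` by two; the truncated
subtraction covers the dimensions zero and one, where the result is the zero space. -/
theorem IsIrreducibleVariety.exists_finrank_inf_ker_add_two_le {n : ℕ} {W : Set (Fin n → ℂ)}
    (hW : IsIrreducibleVariety W) (L : Submodule ℝ (RealCoordRing (W ∪ conjSet W)))
    [FiniteDimensional ℝ L] :
    ∃ z : W, Module.finrank ℝ ↥(L ⊓ LinearMap.ker (evalLeft z).toLinearMap) ≤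
      Module.finrank ℝ L - 2 := by
  have hrn (z : W) : Module.finrank ℝ (LinearMap.range ((evalLeft z).toLinearMap.domRestrict L)) +
      Module.finrank ℝ ↥(L ⊓ LinearMap.ker (evalLeft z).toLinearMap) = Module.finrank ℝ L := by
    rw [← LinearMap.finrank_range_add_finrank_ker ((evalLeft z).toLinearMap.domRestrict L),
      LinearMap.ker_domRestrict, ← Submodule.finrank_map_subtype_eq, Submodule.map_comap_subtype]
  rcases lt_or_ge (Module.finrank ℝ L) 2 with h2 | h2
  · by_cases hL : L = ⊥
    · obtain ⟨z, hz⟩ := hW.2.1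
      refine ⟨⟨z, hz⟩, ?_⟩
      have h0 : Module.finrank ℝ L = 0 := hL ▸ finrank_bot ℝ _
      have := hrn ⟨z, hz⟩
      omega
    · obtain ⟨f, hf, hf0⟩ := L.exists_mem_ne_zero_of_ne_bot hL
      obtain ⟨z, hz⟩ : ∃ z : W, evalLeft z f ≠ 0 := by
        by_contra! h
        exact hf0 (eq_zero_of_evalLeft_eq_zero h)
      refine ⟨z, ?_⟩
      have hpos : 0 < Module.finrank ℝ
          (LinearMap.range ((evalLeft z).toLinearMap.domRestrict L)) :=
        Module.finrank_pos_iff_exists_ne_zero.2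
          ⟨⟨_, ⟨f, hf⟩, rfl⟩, fun h => hz (congrArg Subtype.val h)⟩
      have := hrn z
      omega
  · obtain ⟨v, hv⟩ := exists_linearIndependent_of_le_finrank h2
    obtain ⟨z, hz⟩ := hW.exists_im_mul_conj_ne_zero
      (f := (v 0 : RealCoordRing (W ∪ conjSet W))) (g := v 1) (by
        have := hv.map' L.subtype L.ker_subtype
        convert! this using 1
        ext i
        fin_cases i <;> rfl)
    refine ⟨z, ?_⟩
    -- The imaginary part at `hz` is the determinant of the two values, as vectors in `ℝ²`.
    have hli : LinearIndependent ℝ ![evalLeft z (v 0 : RealCoordRing (W ∪ conjSet W)),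
        evalLeft z (v 1 : RealCoordRing (W ∪ conjSet W))] := by
      rw [LinearIndependent.pair_iff]
      intro s t hst
      generalize evalLeft z (v 0 : RealCoordRing (W ∪ conjSet W)) = a at *
      generalize evalLeft z (v 1 : RealCoordRing (W ∪ conjSet W)) = b at *
      have hre := congrArg Complex.re hst
      have him := congrArg Complex.im hst
      simp only [Complex.add_re, Complex.add_im, Complex.smul_re, Complex.smul_im, smul_eq_mul,
      Complex.zero_re, Complex.zero_im, Complex.mul_im, Complex.conj_re,
      Complex.conj_im] at hre him hz
      constructor
      · refine (mul_eq_zero.1 (?_ : s * (a.re * -b.im + a.im * b.re) = 0)).resolve_right hz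
        linear_combination b.re * him - b.im * hre
      · refine (mul_eq_zero.1 (?_ : t * (a.re * -b.im + a.im * b.re) = 0)).resolve_right hz
        linear_combination a.im * hre - a.re * him
    have hli2 : LinearIndependent ℝ fun i : Fin 2 =>
        (⟨_, v i, rfl⟩ : LinearMap.range ((evalLeft z).toLinearMap.domRestrict L)) := by
      refine LinearIndependent.of_comp (Submodule.subtype _) ?_
      convert! hli using 1
      ext i
      fin_cases i <;> rfl
    have hcard := hli2.fintype_card_le_finrank
    rw [Fintype.card_fin] at hcard
    have := hrn z
    omega

/-- Existence of a single poised tuple, by choosing the samples one after the other. -/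
theorem IsIrreducibleVariety.exists_poised {n : ℕ} {W : Set (Fin n → ℂ)}
    (hW : IsIrreducibleVariety W) (S : ℕ) (L : Submodule ℝ (RealCoordRing (W ∪ conjSet W)))
    [FiniteDimensional ℝ L] (hL : Module.finrank ℝ L ≤ 2 * S) :
    ∃ Z : Fin S → W, Poised L (sampleSet Z) := by
  induction S generalizing L with
  | zero =>
    refine ⟨Fin.elim0, fun f hf _ => ?_⟩
    rw [Submodule.finrank_eq_zero.1 (by omega : Module.finrank ℝ L = 0)] at hf
    exact hf
  | succ S ih =>
    obtain ⟨z, hz⟩ := hW.exists_finrank_inf_ker_add_two_le L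
    have : FiniteDimensional ℝ ↥(L ⊓ LinearMap.ker (evalLeft z).toLinearMap) :=
      Submodule.finiteDimensional_of_le inf_le_left
    obtain ⟨Z, hZ⟩ := ih (L ⊓ LinearMap.ker (evalLeft z).toLinearMap) (by omega)
    refine ⟨Fin.cons z Z, poised_sampleSet_iff.2 fun f hf h => ?_⟩
    exact poised_sampleSet_iff.1 hZ f ⟨hf, h 0⟩ fun i => h i.succ

/-! ### The Gram determinant as a polynomial in the samples and their conjugates -/

/-- The real Gram matrix of the family `f` for the positive semidefinite form
`(g, h) ↦ ∑ i, 2 Re (g (Z i) * conj (h (Z i)))`. -/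
noncomputable def sampleGram {n S D : ℕ} {W : Set (Fin n → ℂ)}
    (f : Fin D → RealCoordRing (W ∪ conjSet W)) (Z : Fin S → W) : Matrix (Fin D) (Fin D) ℝ :=
  Matrix.of fun j k => ∑ i, 2 * (evalLeft (Z i) (f j) * conj (evalLeft (Z i) (f k))).re

theorem sampleGram_mulVec {n S D : ℕ} {W : Set (Fin n → ℂ)}
    (f : Fin D → RealCoordRing (W ∪ conjSet W)) (Z : Fin S → W) (c : Fin D → ℝ) (j : Fin D) :
    (sampleGram f Z).mulVec c j =
      ∑ i, 2 * (evalLeft (Z i) (f j) * conj (evalLeft (Z i) (∑ k, c k • f k))).re := by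
  simp only [sampleGram, Matrix.mulVec, dotProduct, Matrix.of_apply, Finset.sum_mul, map_sum,
    Finset.mul_sum, Complex.re_sum]
  rw [Finset.sum_comm]
  refine Finset.sum_congr rfl fun i _ => Finset.sum_congr rfl fun k _ => ?_
  simp
  ring

theorem dotProduct_sampleGram_mulVec {n S D : ℕ} {W : Set (Fin n → ℂ)}
    (f : Fin D → RealCoordRing (W ∪ conjSet W)) (Z : Fin S → W) (c : Fin D → ℝ) :
    c ⬝ᵥ (sampleGram f Z).mulVec c =
      ∑ i, 2 * Complex.normSq (evalLeft (Z i) (∑ k, c k • f k)) := by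
  simp only [dotProduct, sampleGram_mulVec, Finset.mul_sum]
  rw [Finset.sum_comm]
  refine Finset.sum_congr rfl fun i _ => ?_
  rw [← Complex.ofReal_re (Complex.normSq _), ← Complex.mul_conj]
  generalize hw : conj (evalLeft (Z i) (∑ k, c k • f k)) = w
  simp only [map_sum, map_smul, Finset.sum_mul, Complex.re_sum, Finset.mul_sum]
  refine Finset.sum_congr rfl fun k _ => ?_
  simp
  ring

theorem det_sampleGram_ne_zero_iff {n S D : ℕ} {W : Set (Fin n → ℂ)}
    {L : Submodule ℝ (RealCoordRing (W ∪ conjSet W))} (b : Module.Basis (Fin D) ℝ L)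
    (Z : Fin S → W) :
    (sampleGram (fun j => (b j : RealCoordRing (W ∪ conjSet W))) Z).det ≠ 0 ↔
      Poised L (sampleSet Z) := by
  rw [poised_sampleSet_iff]
  have hsum (c : Fin D → ℝ) : ∑ k, c k • (b k : RealCoordRing (W ∪ conjSet W)) =
      (b.equivFun.symm c : L) := by
    simp [Module.Basis.equivFun_symm_apply]
  constructor
  · intro hdet f hf h
    have h0 : b.equivFun ⟨f, hf⟩ = 0 := by
      refine Matrix.eq_zero_of_mulVec_eq_zero hdet (funext fun j => ?_)
      rw [sampleGram_mulVec, hsum, LinearEquiv.symm_apply_apply]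
      simp [h]
    exact congrArg Subtype.val (b.equivFun.map_eq_zero_iff.1 h0)
  · intro h hdet
    obtain ⟨c, hc0, hc⟩ := Matrix.exists_mulVec_eq_zero_iff.2 hdet
    refine hc0 (b.equivFun.symm.map_eq_zero_iff.1 (Subtype.ext ?_))
    have hquad := dotProduct_sampleGram_mulVec
      (fun j => (b j : RealCoordRing (W ∪ conjSet W))) Z c
    rw [hc, dotProduct_zero, hsum, eq_comm, Finset.sum_eq_zero_iff_of_nonneg
      fun i _ => mul_nonneg zero_le_two (Complex.normSq_nonneg _)] at hquad
    exact h _ (b.equivFun.symm c).2 fun i => by simpa using hquad i (Finset.mem_univ i)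

theorem exists_evalConj_eq_det_sampleGram {n S D : ℕ} {W : Set (Fin n → ℂ)}
    (f : Fin D → RealCoordRing (W ∪ conjSet W)) :
    ∃ q : MvPolynomial ((Fin S × Fin n) ⊕ (Fin S × Fin n)) ℂ,
      ∀ Z : Fin S → W, evalConj q (fun i => (Z i : Fin n → ℂ)) = (sampleGram f Z).det := by
  choose p hp using fun j => Ideal.Quotient.mk_surjective (f j)
  let x (i : Fin S) (j : Fin D) : MvPolynomial ((Fin S × Fin n) ⊕ (Fin S × Fin n)) ℂ :=
    rename (fun k => Sum.inl (i, k)) (map (algebraMap ℝ ℂ) (p j))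
  let y (i : Fin S) (j : Fin D) : MvPolynomial ((Fin S × Fin n) ⊕ (Fin S × Fin n)) ℂ :=
    rename (fun k => Sum.inr (i, k)) (map (algebraMap ℝ ℂ) (p j))
  have hx (Z : Fin S → W) (i j) :
      evalConj (x i j) (fun i => (Z i : Fin n → ℂ)) = evalLeft (Z i) (f j) := by
    rw [evalConj, eval_rename, eval_map, ← hp, evalLeft_mk, aeval_def]
    rfl
  have hy (Z : Fin S → W) (i j) :
      evalConj (y i j) (fun i => (Z i : Fin n → ℂ)) = conj (evalLeft (Z i) (f j)) := by
    rw [evalConj, eval_rename, eval_map, ← hp, evalLeft_mk, ← aeval_conj, aeval_def]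
    rfl
  -- `x i j * y i k + y i j * x i k` evaluates to a complex number plus its conjugate, which is
  -- twice its real part.
  refine ⟨(Matrix.of fun j k => ∑ i, (x i j * y i k + y i j * x i k)).det, fun Z => ?_⟩
  rw [evalConj, RingHom.map_det, ← Complex.ofRealHom_eq_coe, RingHom.map_det]
  congr 1
  ext j k : 2
  simp only [RingHom.mapMatrix_apply, Matrix.map_apply, Matrix.of_apply, map_sum, map_add, map_mul,
    sampleGram]
  refine Finset.sum_congr rfl fun i _ => ?_
  simp only [evalConj] at hx hy
  rw [hx, hx, hy, hy]
  apply Complex.ext <;> simp <;> ring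

/-! ### Generic poisedness -/

theorem mainTheorem1 {n : ℕ} (W : Set (Fin n → ℂ)) (hW : IsIrreducibleVariety W)
    (L : Submodule ℝ (RealCoordRing (W ∪ conjSet W))) (D : ℕ) (hD : Module.rank ℝ L = (D : Cardinal))
    (S : ℕ) (hS : (D : ℝ) / 2 ≤ (S : ℝ)) :
    CGenerically W S (fun Z => Poised L (sampleSet Z)) := by
  have hfree : Module.Free ℝ L := Module.Free.of_divisionRing ℝ L
  have hfin : FiniteDimensional ℝ L :=
    Module.rank_lt_aleph0_iff.1 (hD ▸ natCast_lt_aleph0)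
  have hfr : Module.finrank ℝ L = D := Module.finrank_eq_of_rank_eq hD
  have hDS : D ≤ 2 * S := by
    have : (D : ℝ) ≤ 2 * S := by linarith
    exact_mod_cast this
  let b : Module.Basis (Fin D) ℝ L := Module.finBasisOfFinrankEq ℝ L hfr
  obtain ⟨q, hq⟩ := exists_evalConj_eq_det_sampleGram (S := S)
    (fun j => (b j : RealCoordRing (W ∪ conjSet W)))
  have hiff (Z : Fin S → W) : evalConj q (fun i => (Z i : Fin n → ℂ)) ≠ 0 ↔
      Poised L (sampleSet Z) := by
    rw [hq, Complex.ofReal_ne_zero, det_sampleGram_ne_zero_iff]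
  obtain ⟨Z, hZ⟩ := hW.exists_poised S L (hfr.trans_le hDS)
  exact ⟨q, ⟨Z, (hiff Z).2 hZ⟩, fun Z => (hiff Z).1⟩
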